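/- Let $m \ge 1$ be an integer, let $H$ be a complex Hilbert space and let $T$ be a bounded linear operator on $H$ which is a $B_m$-contraction, that is, $T$ is of class $C_{\cdot 0}$ ($T^{*l}h \to 0$ as $l \to \infty$ for every $h \in H$) and $$\Delta_{m,T} := \sum_{k=0}^m (-1)^k \binom{m}{k} T^k T^{*k} \ge 0 .$$ Put $D_{m,T} = \Delta_{m,T}^{1/2}$ and $\mathcal D_{m,T} = \overline{\operatorname{ran}}\, D_{m,T}$. For a complex Hilbert space $\mathcal F$ and an integer $k\ge 1$, let $A^2_k(\mathcal F)$ be the Hilbert space of $\mathcal F$-valued functions on the open unit disc $\mathbb D$ with reproducing kernel $(z,w) \mapsto (1 - z\bar w)^{-k} I_{\mathcal F}$ (so $A^2_1(\mathcal F) = H^2(\mathcal F)$ is the Hardy space), and let $M_z$ be the bounded operator $(M_z f)(w) = w f(w)$ on it. Then there exist a complex Hilbert space $\mathcal E$ and a holomorphic function $\theta : \mathbb D \to \mathcal B(\mathcal E, \mathcal D_{m,T})$ such that $\theta f \in A^2_m(\mathcal D_{m,T})$ for all $f \in H^2(\mathcal E)$, the (automatically bounded) operator $M_\theta : H^2(\mathcal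 E) \to A^2_m(\mathcal D_{m,T})$, $M_\theta f = \theta f$, is a partial isometry, and $$T \cong P_{\mathcal Q_\theta} M_z|_{\mathcal Q_\theta}, \qquad \mathcal Q_\theta = A^2_m(\mathcal D_{m,T}) \ominus \theta H^2(\mathcal E),$$ where $\cong$ denotes unitary equivalence and $P_{\mathcal Q_\theta}$ is the orthogonal projection of $A^2_m(\mathcal D_{m,T})$ onto $\mathcal Q_\theta$. -/

import Mathlib

universe u

open scoped ComplexOrder ComplexConjugate Complex.UnitDisc InnerProductSpace

noncomputable section

namespace BergmanModel

/-! ### The weighted Bergman spaces `A²_m(E)` -/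

section Bergman

variable {E : Type*} [NormedAddCommGroup E] [InnerProductSpace ℂ E] [CompleteSpace E]

/-- The operator-valued weighted Bergman kernel `B_m(z, w) I_E = (1 - z w̄)⁻ᵐ I_E` on the disc. -/
def bergmanKernel (m : ℕ) (E : Type*) [NormedAddCommGroup E] [InnerProductSpace ℂ E]
    [CompleteSpace E] : Matrix 𝔻 𝔻 (E →L[ℂ] E) :=
  .of fun z w ↦ ((1 - (z : ℂ) * conj (w : ℂ)) ^ m)⁻¹ • ContinuousLinearMap.id ℂ E

lemma norm_mul_conj_lt_one (z w : 𝔻) : ‖(z : ℂ) * conj (w : ℂ)‖ < 1 := by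
  rw [norm_mul, RCLike.norm_conj]
  exact mul_lt_one_of_nonneg_of_lt_one_left (norm_nonneg _) z.norm_lt_one w.norm_lt_one.le

lemma one_sub_mul_conj_ne_zero (z w : 𝔻) : (1 : ℂ) - (z : ℂ) * conj (w : ℂ) ≠ 0 := by
  intro h
  have h1 := norm_mul_conj_lt_one z w
  rw [← sub_eq_zero.mp h] at h1
  simp at h1

/-- The scalar Bergman kernel is a power series in `z w̄` with nonnegative coefficients. -/
lemma exists_hasSum_bergman (m : ℕ) : ∃ a : ℕ → ℝ, (∀ n, 0 ≤ a n) ∧ ∀ z w : 𝔻,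
    HasSum (fun n ↦ (a n : ℂ) * ((z : ℂ) * conj (w : ℂ)) ^ n)
      ((1 - (z : ℂ) * conj (w : ℂ)) ^ m)⁻¹ := by
  cases m with
  | zero =>
    refine ⟨fun n ↦ if n = 0 then 1 else 0, fun n ↦ by positivity, fun z w ↦ ?_⟩
    convert hasSum_single (f := fun n ↦ (((if n = 0 then 1 else 0 : ℝ)) : ℂ) *
      ((z : ℂ) * conj (w : ℂ)) ^ n) 0 ?_ using 1
    · simp
    · intro n hn
      simp [hn]
  | succ k =>
    refine ⟨fun n ↦ ((n + k).choose k : ℝ), fun n ↦ by positivity, fun z w ↦ ?_⟩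
    have := hasSum_choose_mul_geometric_of_norm_lt_one k (norm_mul_conj_lt_one z w)
    simpa using this

lemma bergman_sum_nonneg {E : Type*} [NormedAddCommGroup E] [InnerProductSpace ℂ E]
    (m : ℕ) (v : 𝔻 →₀ E) :
    0 ≤ RCLike.re (v.sum fun x w ↦ v.sum fun x' w' ↦
      ⟪((1 - (x' : ℂ) * conj (x : ℂ)) ^ m)⁻¹ • w, w'⟫_ℂ) := by
  obtain ⟨a, ha, hs⟩ := exists_hasSum_bergman m
  have key : HasSum (fun n ↦ (a n : ℂ) *
      ((‖v.sum fun x w ↦ (conj (x : ℂ)) ^ n • w‖ ^ 2 : ℝ) : ℂ))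
      (v.sum fun x w ↦ v.sum fun x' w' ↦
        ⟪((1 - (x' : ℂ) * conj (x : ℂ)) ^ m)⁻¹ • w, w'⟫_ℂ) := by
    have h1 : HasSum (fun n ↦ v.sum fun x w ↦ v.sum fun x' w' ↦
        conj ((a n : ℂ) * ((x' : ℂ) * conj (x : ℂ)) ^ n) * ⟪w, w'⟫_ℂ)
      (v.sum fun x w ↦ v.sum fun x' w' ↦
        ⟪((1 - (x' : ℂ) * conj (x : ℂ)) ^ m)⁻¹ • w, w'⟫_ℂ) := by
      refine hasSum_sum fun x _ ↦ hasSum_sum fun x' _ ↦ ?_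
      beta_reduce
      rw [inner_smul_left]
      exact (Complex.hasSum_conj'.mpr (by simpa using hs x' x)).mul_right _
    convert h1 using 2 with n
    push_cast
    have hn (y : E) : ((‖y‖ : ℝ) : ℂ) ^ 2 = ⟪y, y⟫_ℂ := (inner_self_eq_norm_sq_to_K (𝕜 := ℂ) y).symm
    rw [hn]
    simp only [Finsupp.sum, sum_inner, inner_sum, inner_smul_left, inner_smul_right,
      Finset.mul_sum]
    rw [Finset.sum_comm]
    refine Finset.sum_congr rfl fun x _ ↦ Finset.sum_congr rfl fun x' _ ↦ ?_
    simp only [map_mul, map_pow, Complex.conj_conj, Complex.conj_ofReal]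
    ring
  have hre := Complex.hasSum_re key
  refine hre.nonneg fun n ↦ ?_
  rw [← Complex.ofReal_mul, Complex.ofReal_re]
  exact mul_nonneg (ha n) (by positivity)

lemma posSemidef_bergmanKernel (m : ℕ) : (bergmanKernel m E).PosSemidef := by
  have h := (RKHS.posSemidef_tfae (K := bergmanKernel m E)).out 0 2
  refine h.mpr ⟨?_, fun v ↦ ?_⟩
  · ext z w x
    have h1 : star (ContinuousLinearMap.id ℂ E) = ContinuousLinearMap.id ℂ E :=
      star_one (E →L[ℂ] E)
    simp [bergmanKernel, mul_comm, h1]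
  · exact bergman_sum_nonneg m v

instance (m : ℕ) : Fact (bergmanKernel m E).PosSemidef := ⟨posSemidef_bergmanKernel m⟩

/-- The `E`-valued weighted Bergman space `A²_m(E)`: the reproducing kernel Hilbert space of
`E`-valued functions on the disc with kernel `(1 - z w̄)⁻ᵐ I_E`. For `m = 1` this is the Hardy
space `H²(E)`. -/
abbrev A2 (m : ℕ) (E : Type*) [NormedAddCommGroup E] [InnerProductSpace ℂ E] [CompleteSpace E] :=
  RKHS.OfKernel (bergmanKernel m E)

end Bergman

/-! ### Multipliers -/

section Multipliers

variable {E F : Type*} [NormedAddCommGroup E] [InnerProductSpace ℂ E] [CompleteSpace E]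
  [NormedAddCommGroup F] [InnerProductSpace ℂ F] [CompleteSpace F]

/-- `θ` is a multiplier from `A²_k(E)` to `A²_m(F)`: it is holomorphic on the unit disc and
`θ f ∈ A²_m(F)` for all `f ∈ A²_k(E)`. Only the values of `θ` on the open disc matter. -/
structure IsMultiplier (k m : ℕ) (θ : ℂ → E →L[ℂ] F) : Prop where
  holomorphic : DifferentiableOn ℂ θ (Metric.ball 0 1)
  maps : ∀ f : A2 k E, ∃ g : A2 m F, ∀ z : 𝔻, g z = θ z (f z)

namespace IsMultiplier

variable {k m : ℕ} {θ : ℂ → E →L[ℂ] F}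

/-- The multiplication operator as a linear map. -/
def mulLinear (h : IsMultiplier k m θ) : A2 k E →ₗ[ℂ] A2 m F where
  toFun f := (h.maps f).choose
  map_add' f g := RKHS.ext fun z ↦ by
    rw [(h.maps _).choose_spec z]
    simp [(h.maps f).choose_spec z, (h.maps g).choose_spec z]
  map_smul' c f := RKHS.ext fun z ↦ by
    rw [(h.maps _).choose_spec z]
    simp [(h.maps f).choose_spec z]

lemma mulLinear_apply (h : IsMultiplier k m θ) (f : A2 k E) (z : 𝔻) :
    h.mulLinear f z = θ z (f z) :=
  (h.maps f).choose_spec z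

/-- The multiplication operator `M_θ f = θ f`, bounded by the closed graph theorem. -/
def mulOp (h : IsMultiplier k m θ) : A2 k E →L[ℂ] A2 m F :=
  ContinuousLinearMap.ofSeqClosedGraph (g := h.mulLinear) fun u x y hu hy ↦ RKHS.ext fun z ↦ by
    refine tendsto_nhds_unique (((RKHS.continuous_eval z).tendsto y).comp hy) ?_
    have h1 : Continuous fun f : A2 k E ↦ h.mulLinear f z := by
      simp only [mulLinear_apply]
      exact (θ z).continuous.comp (RKHS.continuous_eval z)
    exact (h1.tendsto x).comp hu

@[simp]
lemma mulOp_apply (h : IsMultiplier k m θ) (f : A2 k E) (z : 𝔻) :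
    h.mulOp f z = θ z (f z) :=
  h.mulLinear_apply f z

end IsMultiplier

end Multipliers

/-! ### The shift -/

section Shift

variable {E : Type*} [NormedAddCommGroup E] [InnerProductSpace ℂ E] [CompleteSpace E]

/-- Finite combinations `∑ c(x) B_m(·, x) v(x)` of kernel functions. -/
def kerSum (m : ℕ) (c : 𝔻 → ℂ) : (𝔻 →₀ E) →ₗ[ℂ] A2 m E :=
  Finsupp.lsum ℂ fun x ↦ c x • (RKHS.kerFun (A2 m E) x : E →ₗ[ℂ] A2 m E)

lemma norm_sq_kerSum (m : ℕ) (c : 𝔻 → ℂ) (v : 𝔻 →₀ E) :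
    ‖kerSum m c v‖ ^ 2 = RCLike.re (v.sum fun x w ↦ v.sum fun x' w' ↦
      conj (c x) * c x' * ⟪((1 - (x' : ℂ) * conj (x : ℂ)) ^ m)⁻¹ • w, w'⟫_ℂ) := by
  rw [← inner_self_eq_norm_sq (𝕜 := ℂ)]
  congr 1
  simp only [kerSum, Finsupp.lsum_apply, Finsupp.sum, sum_inner, inner_sum, LinearMap.smul_apply,
    inner_smul_left, inner_smul_right, ContinuousLinearMap.coe_coe, ← RKHS.kernel_inner,
    RKHS.OfKernel.kernel_ofKernel, Finset.mul_sum]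
  rw [Finset.sum_comm]
  refine Finset.sum_congr rfl fun x _ ↦ Finset.sum_congr rfl fun x' _ ↦ ?_
  simp only [bergmanKernel, Matrix.of_apply, FunLike.coe_smul, Pi.smul_apply,
    ContinuousLinearMap.id_apply, inner_smul_left]
  ring

lemma norm_kerSum_conj_le {m : ℕ} (hm : 1 ≤ m) (v : 𝔻 →₀ E) :
    ‖kerSum m (fun x ↦ conj (x : ℂ)) v‖ ≤ 1 * ‖kerSum m (fun _ ↦ 1) v‖ := by
  rw [one_mul]
  refine abs_le_of_sq_le_sq' ?_ (norm_nonneg _) |>.2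
  rw [norm_sq_kerSum, norm_sq_kerSum, ← sub_nonneg, ← map_sub]
  refine (bergman_sum_nonneg (m - 1) v).trans_eq (congrArg RCLike.re (Eq.symm ?_))
  simp only [Finsupp.sum]
  rw [← Finset.sum_sub_distrib]
  refine Finset.sum_congr rfl fun x _ ↦ ?_
  rw [← Finset.sum_sub_distrib]
  refine Finset.sum_congr rfl fun x' _ ↦ ?_
  obtain ⟨n, rfl⟩ : ∃ n, m = n + 1 := ⟨m - 1, by omega⟩
  have h := one_sub_mul_conj_ne_zero x x'
  simp only [inner_smul_left, Nat.add_sub_cancel, map_inv₀, map_pow, map_sub, map_mul, map_one,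
    Complex.conj_conj]
  rw [mul_comm (x : ℂ)] at h
  field_simp
  ring

/-- Multiplication by the coordinate function `z` maps `A²_m(E)` into itself. -/
lemma isMultiplier_shift {m : ℕ} (hm : 1 ≤ m) :
    IsMultiplier (E := E) (F := E) m m (fun z ↦ z • ContinuousLinearMap.id ℂ E) where
  holomorphic := by fun_prop
  maps f := by
    have hd : DenseRange (kerSum m (fun _ ↦ 1) : (𝔻 →₀ E) →ₗ[ℂ] A2 m E) := by
      have h := RKHS.kerFun_dense (A2 m E)
      have hle : Submodule.span ℂ {RKHS.kerFun (A2 m E) x v | (x) (v)} ≤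
          LinearMap.range (kerSum m (fun _ ↦ 1) : (𝔻 →₀ E) →ₗ[ℂ] A2 m E) := by
        rw [Submodule.span_le]
        rintro _ ⟨x, v, rfl⟩
        exact ⟨Finsupp.single x v, by simp [kerSum]⟩
      rw [DenseRange, dense_iff_closure_eq, Set.eq_univ_iff_forall]
      intro g
      have hg : g ∈ (Submodule.span ℂ {RKHS.kerFun (A2 m E) x v | (x) (v)}).topologicalClosure := by
        rw [h]; trivial
      exact closure_mono hle hg
    let S : A2 m E →L[ℂ] A2 m E :=
      (kerSum m (fun x ↦ conj (x : ℂ))).extendOfNorm (kerSum m (fun _ ↦ 1))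
    have hS (x : 𝔻) (v : E) : S (RKHS.kerFun (A2 m E) x v) =
        conj (x : ℂ) • RKHS.kerFun (A2 m E) x v := by
      have := LinearMap.extendOfNorm_eq (f := kerSum m (fun x : 𝔻 ↦ conj (x : ℂ)))
        (e := kerSum (E := E) m (fun _ ↦ 1)) hd ⟨1, norm_kerSum_conj_le hm⟩ (Finsupp.single x v)
      simpa [kerSum, S] using this
    refine ⟨S.adjoint f, fun z ↦ ?_⟩
    refine ext_inner_left ℂ fun v ↦ ?_
    rw [← RKHS.kerFun_inner, ContinuousLinearMap.adjoint_inner_right, hS]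
    simp [inner_smul_left, inner_smul_right]

/-- The shift `(M_z f)(w) = w f(w)` on `A²_m(E)`, `m ≥ 1`. -/
def shift (E : Type*) [NormedAddCommGroup E] [InnerProductSpace ℂ E] [CompleteSpace E]
    {m : ℕ} (hm : 1 ≤ m) : A2 m E →L[ℂ] A2 m E :=
  (isMultiplier_shift (E := E) hm).mulOp

lemma shift_apply {m : ℕ} (hm : 1 ≤ m) (f : A2 m E) (z : 𝔻) :
    shift E hm f z = (z : ℂ) • f z := by
  simp [shift]

end Shift

/-! ### Operators -/

section Operators

variable {H K : Type*} [NormedAddCommGroup H] [InnerProductSpace ℂ H] [CompleteSpace H]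
  [NormedAddCommGroup K] [InnerProductSpace ℂ K] [CompleteSpace K]

/-- A partial isometry: a bounded operator that is isometric on the orthogonal complement of its
kernel. -/
def IsPartialIsometry (V : H →L[ℂ] K) : Prop :=
  ∀ x ∈ (LinearMap.ker (V : H →ₗ[ℂ] K))ᗮ, ‖V x‖ = ‖x‖

/-- The class `C_{·0}`: `T^{*l} → 0` in the strong operator topology. -/
def IsCDotZero (T : H →L[ℂ] H) : Prop :=
  ∀ h : H, Filter.Tendsto (fun l : ℕ ↦ (T.adjoint ^ l) h) Filter.atTop (nhds 0)

/-- The hereditary calculus `B_m⁻¹(z, w)(T, T*) = ∑_{k=0}^m (-1)^k (m choose k) T^k T^{*k}`. -/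
def bergmanInv (m : ℕ) (T : H →L[ℂ] H) : H →L[ℂ] H :=
  ∑ k ∈ Finset.range (m + 1), ((-1 : ℂ) ^ k * (m.choose k : ℂ)) • (T ^ k * T.adjoint ^ k)

/-- `T` is a `B_m`-contraction: it is of class `C_{·0}` and `B_m⁻¹(z, w)(T, T*) ≥ 0`. -/
structure IsBergmanContraction (m : ℕ) (T : H →L[ℂ] H) : Prop where
  cDotZero : IsCDotZero T
  nonneg : (bergmanInv m T).IsPositive

/-- The defect operator `D_{m,T}`: the positive square root of `B_m⁻¹(z, w)(T, T*)`. -/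
def defectOp (m : ℕ) (T : H →L[ℂ] H) : H →L[ℂ] H :=
  CFC.sqrt (bergmanInv m T)

/-- The defect space `𝒟_{m,T}`: the closure of the range of the defect operator. -/
abbrev defectSpace (m : ℕ) (T : H →L[ℂ] H) : Submodule ℂ H :=
  (LinearMap.range (defectOp m T : H →ₗ[ℂ] H)).topologicalClosure

/-- The compression `P_Q M|_Q` of an operator `M` to a closed subspace `Q`. -/
def compression (M : K →L[ℂ] K) (Q : Submodule ℂ K) [Q.HasOrthogonalProjection] : Q →L[ℂ] Q :=
  Q.orthogonalProjectionOnto ∘L M ∘L Q.subtypeL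

/-- Unitary equivalence of bounded operators on Hilbert spaces. -/
def UnitarilyEquivalent (S : H →L[ℂ] H) (T : K →L[ℂ] K) : Prop :=
  ∃ U : H ≃ₗᵢ[ℂ] K, ∀ h, U (S h) = T (U h)

end Operators

end BergmanModel

end

/-!
# Beurling-type model of `B_m`-contractions

Let `Δ_j = ∑ (-1)^k (j choose k) T^k T^{*k}`. Then `Δ_{j+1} = Δ_j - T Δ_j T*`, so `Δ_{j+1} ≥ 0` and
`T*ˡ → 0` strongly make `⟪Δ_j T*ˡ h, T*ˡ h⟫` decrease to `0`. Hence all `Δ_j` with `j ≤ m` are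
positive (`defectForm_nonneg`), and summing the telescoping series `m` times gives
`‖h‖² = ∑ₙ (n + m - 1 choose m - 1) ‖D T*ⁿ h‖²` (`hasSum_choose_mul_defectForm`).

The weights are the Taylor coefficients of `(1 - x)⁻ᵐ`. Since `A²_m(F)` is the space of power series
`∑ √(n + m - 1 choose m - 1) zⁿ cₙ` with `c ∈ ℓ²(F)` (`exists_coeffEquiv`), the map
`V h = D (1 - z T*)⁻ᵐ h` is an isometry of `H` into `A²_m` over the defect space, and
`V T* = M_z* V` (`exists_modelIsometry`). So `T` is the compression of `M_z` to the range of `V`.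

The orthogonal complement `S` of that range is invariant under `M_z`, and it remains to write it as
the range of a multiplier (`exists_isMultiplier_range_eq`). With `P` the projection onto `S`,
invariance and `‖M_z‖ ≤ 1` give `P - M_z P M_z* = C C* ≥ 0` (`exists_sq_eq_sub_conj`). For
`θ(z) = ev_z ∘ C` this says that the reproducing kernel of `S` is
`θ(z) θ(w)* / (1 - z w̄)`, that is `M_θ M_θ* = P` on kernel functions (`exists_isMultiplier`). An
operator with `M M* = P` is a partial isometry with range `S`.
-/

namespace BergmanModel

/-! ### Operators on a reproducing kernel space from their values on kernel functions -/

section Kernel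

variable {X V A G G' : Type*} [NormedAddCommGroup V] [InnerProductSpace ℂ V] [CompleteSpace V]
  [NormedAddCommGroup A] [InnerProductSpace ℂ A] [CompleteSpace A] [RKHS ℂ A X V]
  [NormedAddCommGroup G] [InnerProductSpace ℂ G]
  [NormedAddCommGroup G'] [InnerProductSpace ℂ G'] [CompleteSpace G']

lemma clm_ext_kerFun {R R' : A →L[ℂ] G}
    (h : ∀ x v, R (RKHS.kerFun A x v) = R' (RKHS.kerFun A x v)) : R = R' := by
  refine ContinuousLinearMap.ext_on (s := {RKHS.kerFun A x v | (x) (v)}) ?_ ?_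
  · exact Submodule.dense_iff_topologicalClosure_eq_top.mpr (RKHS.kerFun_dense A)
  · rintro _ ⟨x, v, rfl⟩
    exact h x v

variable (A) in
lemma denseRange_lsum_kerFun :
    DenseRange (Finsupp.lsum ℂ fun x ↦ (RKHS.kerFun A x : V →ₗ[ℂ] A)) := by
  have hle : Submodule.span ℂ {RKHS.kerFun A x v | (x) (v)} ≤
      LinearMap.range (Finsupp.lsum ℂ fun x ↦ (RKHS.kerFun A x : V →ₗ[ℂ] A)) := by
    rw [Submodule.span_le]
    rintro _ ⟨x, v, rfl⟩
    exact ⟨Finsupp.single x v, by simp⟩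
  exact (Submodule.dense_iff_topologicalClosure_eq_top.mpr (RKHS.kerFun_dense A)).mono hle

/-- If the vectors `Φ x v` have the same inner products as the images `B (K_x v)` of the kernel
functions under a bounded operator `B`, then `K_x v ↦ Φ x v` extends to a bounded operator `R`
with `R* R = B* B`. -/
lemma exists_clm_kerFun [CompleteSpace G] (B : A →L[ℂ] G') (Φ : X → V →ₗ[ℂ] G)
    (h : ∀ x x' v v', ⟪Φ x v, Φ x' v'⟫_ℂ =
      ⟪B (RKHS.kerFun A x v), B (RKHS.kerFun A x' v')⟫_ℂ) :
    ∃ R : A →L[ℂ] G, (∀ x v, R (RKHS.kerFun A x v) = Φ x v) ∧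
      R.adjoint ∘L R = B.adjoint ∘L B := by
  let e : (X →₀ V) →ₗ[ℂ] A :=
    Finsupp.lsum ℂ fun x ↦ (RKHS.kerFun A x : V →ₗ[ℂ] A)
  have hd : DenseRange e := denseRange_lsum_kerFun A
  let f : (X →₀ V) →ₗ[ℂ] G := Finsupp.lsum ℂ Φ
  have hn (v : X →₀ V) : ‖f v‖ = ‖B (e v)‖ := by
    have : ⟪f v, f v⟫_ℂ = ⟪B (e v), B (e v)⟫_ℂ := by
      simp only [f, e, Finsupp.lsum_apply, Finsupp.sum, map_sum, sum_inner, inner_sum, h,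
        ContinuousLinearMap.coe_coe]
    rw [inner_self_eq_norm_sq_to_K, inner_self_eq_norm_sq_to_K] at this
    exact (pow_left_inj₀ (norm_nonneg _) (norm_nonneg _) two_ne_zero).mp (by exact_mod_cast this)
  have hR (x : X) (v : V) : f.extendOfNorm e (RKHS.kerFun A x v) = Φ x v := by
    have := LinearMap.extendOfNorm_eq (f := f) (e := e) hd
      ⟨‖B‖, fun v ↦ (hn v).trans_le (B.le_opNorm _)⟩ (Finsupp.single x v)
    simpa [e, f] using this
  refine ⟨f.extendOfNorm e, hR, clm_ext_kerFun fun x v ↦ RKHS.ext fun x' ↦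
    ext_inner_left ℂ fun v' ↦ ?_⟩
  rw [← RKHS.kerFun_inner, ← RKHS.kerFun_inner, ContinuousLinearMap.comp_apply,
    ContinuousLinearMap.comp_apply, ContinuousLinearMap.adjoint_inner_right,
    ContinuousLinearMap.adjoint_inner_right, hR, hR, h]

end Kernel

/-! ### Expansion of the norm along a `B_m`-contraction -/

section Defect

variable {H : Type*} [NormedAddCommGroup H] [InnerProductSpace ℂ H] [CompleteSpace H]
  {T : H →L[ℂ] H}

lemma bergmanInv_zero : bergmanInv 0 T = 1 := by
  simp [bergmanInv]

/-- This holds because the hereditary calculus of order `m` is `(1 - σ)ᵐ 1` for the map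
`σ X = T X T*`. -/
lemma bergmanInv_succ (m : ℕ) :
    bergmanInv (m + 1) T = bergmanInv m T - T * bergmanInv m T * T.adjoint := by
  let σ : (H →L[ℂ] H) →ₗ[ℂ] (H →L[ℂ] H) :=
    LinearMap.mulLeft ℂ T ∘ₗ LinearMap.mulRight ℂ T.adjoint
  have hσ (X : H →L[ℂ] H) : σ X = T * X * T.adjoint := by simp [σ, mul_assoc]
  have hpow (k : ℕ) : (σ ^ k) 1 = T ^ k * T.adjoint ^ k := by
    induction k with
    | zero => simp
    | succ k ih =>
      rw [pow_succ', Module.End.mul_apply, ih, hσ, pow_succ' T, pow_succ T.adjoint]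
      simp only [mul_assoc]
  have key (k : ℕ) : bergmanInv k T = ((1 - σ) ^ k) 1 := by
    rw [sub_eq_neg_add, (Commute.one_right (-σ)).add_pow, bergmanInv, LinearMap.sum_apply]
    refine Finset.sum_congr rfl fun i _ ↦ ?_
    rw [one_pow, mul_one, Module.End.mul_apply, Module.End.natCast_apply, map_nsmul, mul_comm,
      mul_smul, Nat.cast_smul_eq_nsmul]
    rw [← hpow]
    rcases Nat.even_or_odd i with hi | hi
    · rw [hi.neg_pow σ, hi.neg_one_pow, one_smul]
    · rw [hi.neg_pow σ, hi.neg_one_pow, neg_one_smul, LinearMap.neg_apply]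
  rw [key, key, pow_succ', Module.End.mul_apply, LinearMap.sub_apply, Module.End.one_apply, hσ]

/-- The quadratic form of the hereditary calculus. -/
noncomputable def defectForm (m : ℕ) (T : H →L[ℂ] H) (h : H) : ℝ :=
  RCLike.re ⟪bergmanInv m T h, h⟫_ℂ

lemma defectForm_zero (h : H) : defectForm 0 T h = ‖h‖ ^ 2 := by
  rw [defectForm, bergmanInv_zero, one_apply_eq_self, inner_self_eq_norm_sq]

lemma defectForm_succ (m : ℕ) (h : H) :
    defectForm (m + 1) T h = defectForm m T h - defectForm m T (T.adjoint h) := by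
  simp [defectForm, bergmanInv_succ, ← ContinuousLinearMap.adjoint_inner_right]

lemma tendsto_defectForm (hT : IsCDotZero T) (m : ℕ) (h : H) :
    Filter.Tendsto (fun n ↦ defectForm m T ((T.adjoint ^ n) h)) Filter.atTop (nhds 0) := by
  have hc : Continuous (defectForm m T) := by
    unfold defectForm
    fun_prop
  have h0 : defectForm m T 0 = 0 := by simp [defectForm]
  exact h0 ▸ (hc.tendsto 0).comp (hT h)

/-- Positivity descends: `defectForm m` decreases to `0` along the orbits of `T*` as soon as
`defectForm (m + 1)` is nonnegative. -/
lemma defectForm_nonneg (hT : IsCDotZero T) {m : ℕ} (hm : ∀ h, 0 ≤ defectForm m T h)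
    {j : ℕ} (hj : j ≤ m) (h : H) : 0 ≤ defectForm j T h := by
  induction hj using Nat.decreasingInduction generalizing h with
  | self => exact hm h
  | of_succ k _ ih =>
    have hanti : Antitone fun n ↦ defectForm k T ((T.adjoint ^ n) h) :=
      antitone_nat_of_succ_le fun n ↦ by
        have := ih ((T.adjoint ^ n) h)
        rw [defectForm_succ] at this
        rw [pow_succ', mul_apply_eq_comp]
        linarith
    simpa using hanti.le_of_tendsto (tendsto_defectForm hT k h) 0

lemma hasSum_defectForm_succ (hT : IsCDotZero T) (m : ℕ) (hm : ∀ h, 0 ≤ defectForm (m + 1) T h)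
    (h : H) : HasSum (fun n ↦ defectForm (m + 1) T ((T.adjoint ^ n) h)) (defectForm m T h) := by
  rw [hasSum_iff_tendsto_nat_of_nonneg fun n ↦ hm _]
  have (N : ℕ) : ∑ n ∈ Finset.range N, defectForm (m + 1) T ((T.adjoint ^ n) h) =
      defectForm m T h - defectForm m T ((T.adjoint ^ N) h) := by
    simp_rw [defectForm_succ, ← mul_apply_eq_comp, ← pow_succ']
    exact Finset.sum_range_sub' (fun n ↦ defectForm m T ((T.adjoint ^ n) h)) N
  simpa only [this, sub_zero] using (tendsto_defectForm hT m h).const_sub (defectForm m T h)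

/-- Regrouping of a nonnegative double series along the antidiagonals. -/
lemma hasSum_sum_range_mul {c r s : ℕ → ℝ} {t : ℝ} (hc : ∀ n, 0 ≤ c n) (hr : ∀ n, 0 ≤ r n)
    (hs : ∀ i, HasSum (fun l ↦ c l * r (l + i)) (s i)) (ht : HasSum s t) :
    HasSum (fun n ↦ (∑ i ∈ Finset.range (n + 1), c i) * r n) t := by
  have hsum : Summable fun p : ℕ × ℕ ↦ c p.2 * r (p.2 + p.1) := by
    rw [summable_prod_of_nonneg fun p ↦ mul_nonneg (hc _) (hr _)]
    exact ⟨fun i ↦ (hs i).summable, by simpa [(hs _).tsum_eq] using ht.summable⟩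
  have hp : HasSum (fun p : ℕ × ℕ ↦ c p.2 * r (p.2 + p.1)) t := by
    have := hsum.hasSum
    rwa [(this.prod_fiberwise hs).unique ht] at this
  have := ((Finset.HasAntidiagonal.sigmaAntidiagonalEquivProd.hasSum_iff).mpr hp).sigma
    fun n ↦ hasSum_fintype _
  convert this using 2 with n
  rw [Finset.sum_mul, ← Finset.Nat.sum_antidiagonal_eq_sum_range_succ (fun i _ ↦ c i * r n),
    ← Finset.Nat.sum_antidiagonal_swap, ← Finset.sum_coe_sort]
  refine Finset.sum_congr rfl fun p _ ↦ ?_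
  have hp : p.1.1 + p.1.2 = n := Finset.HasAntidiagonal.mem_antidiagonal.mp p.2
  simp [← hp, add_comm]

/-- The norm is recovered from the defect form of order `k + 1` with the Taylor coefficients of
`(1 - x)⁻⁽ᵏ⁺¹⁾` as weights. -/
lemma hasSum_choose_mul_defectForm (hT : IsCDotZero T) (k : ℕ)
    (hk : ∀ h, 0 ≤ defectForm (k + 1) T h) (h : H) :
    HasSum (fun n ↦ ((n + k).choose k : ℝ) * defectForm (k + 1) T ((T.adjoint ^ n) h))
      (‖h‖ ^ 2) := by
  suffices key : ∀ l j, j + l = k → ∀ h, HasSum (fun n ↦ ((n + l).choose l : ℝ) *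
      defectForm (k + 1) T ((T.adjoint ^ n) h)) (defectForm j T h) by
    simpa [defectForm_zero] using key k 0 (by simp) h
  intro l
  induction l with
  | zero =>
    rintro j rfl h
    simpa using hasSum_defectForm_succ hT j hk h
  | succ l ih =>
    intro j hj h
    have hj' : ∀ h, 0 ≤ defectForm (j + 1) T h := defectForm_nonneg hT hk (by omega)
    have := hasSum_sum_range_mul (c := fun n ↦ ((n + l).choose l : ℝ))
      (r := fun n ↦ defectForm (k + 1) T ((T.adjoint ^ n) h)) (fun n ↦ by positivity)
      (fun n ↦ hk _) (fun i ↦ ?_) (hasSum_defectForm_succ hT j hj' h)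
    · simpa only [← Nat.cast_sum, Nat.sum_range_add_choose, add_assoc] using this
    · simpa only [pow_add, mul_apply_eq_comp] using ih (j + 1) (by omega) ((T.adjoint ^ i) h)

end Defect

/-! ### The weighted Bergman space as a space of power series -/

section PowerSeries

variable {F : Type*} [NormedAddCommGroup F] [InnerProductSpace ℂ F]

/-- The norming weights `√((n + k).choose k)` of the space with kernel `(1 - z w̄)⁻⁽ᵏ⁺¹⁾`: the
functions `w ↦ weight k n • wⁿ v` have norm `‖v‖`. -/
noncomputable def weight (k n : ℕ) : ℝ := √((n + k).choose k : ℝ)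

lemma weight_sq (k n : ℕ) : weight k n ^ 2 = ((n + k).choose k : ℝ) :=
  Real.sq_sqrt (by positivity)

lemma weight_pos (k n : ℕ) : 0 < weight k n :=
  Real.sqrt_pos.mpr (by exact_mod_cast Nat.choose_pos (by omega))

lemma weight_nonneg (k n : ℕ) : 0 ≤ weight k n := (weight_pos k n).le

lemma summable_weight_mul_pow (k : ℕ) {r : ℝ} (h0 : 0 ≤ r) (h1 : r < 1) :
    Summable fun n ↦ weight k n * r ^ n := by
  have hr : ‖r‖ < 1 := by rwa [Real.norm_of_nonneg h0]
  refine (hasSum_choose_mul_geometric_of_norm_lt_one k hr).summable.of_nonneg_of_le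
    (fun n ↦ mul_nonneg (weight_nonneg k n) (by positivity)) fun n ↦ ?_
  refine mul_le_mul_of_nonneg_right ?_ (by positivity)
  -- the weights are at least one, so they are dominated by their squares
  have h : (1 : ℝ) ≤ ((n + k).choose k : ℝ) := by
    exact_mod_cast Nat.choose_pos (by omega)
  exact (Real.sqrt_le_sqrt (by nlinarith)).trans_eq (Real.sqrt_sq (by positivity))

/-- The operator power series with uniformly bounded coefficients `b n` and the weights of order
`k + 1`. It converges in norm on the unit disc; outside the disc its value is junk. -/
noncomputable def opSeries {E : Type*} [NormedAddCommGroup E] [InnerProductSpace ℂ E] (k : ℕ)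
    (b : ℕ → E →L[ℂ] F) (z : ℂ) : E →L[ℂ] F :=
  ∑' n, ((weight k n : ℂ) * z ^ n) • b n

section OpSeries

variable {E : Type*} [NormedAddCommGroup E] [InnerProductSpace ℂ E] {k : ℕ} {b : ℕ → E →L[ℂ] F}
  {C : ℝ}

lemma norm_opSeries_term_le (hb : ∀ n, ‖b n‖ ≤ C) (n : ℕ) (z : ℂ) :
    ‖((weight k n : ℂ) * z ^ n) • b n‖ ≤ weight k n * ‖z‖ ^ n * C := by
  rw [norm_smul, norm_mul, norm_pow, Complex.norm_real, Real.norm_of_nonneg (weight_nonneg k n)]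
  exact mul_le_mul_of_nonneg_left (hb n) (mul_nonneg (weight_nonneg k n) (by positivity))

lemma differentiableOn_opSeries [CompleteSpace F] (hb : ∀ n, ‖b n‖ ≤ C) :
    DifferentiableOn ℂ (opSeries k b) (Metric.ball 0 1) := by
  intro z hz
  obtain ⟨r, hzr, hr⟩ := exists_between (mem_ball_zero_iff.mp hz)
  refine DifferentiableAt.differentiableWithinAt ?_
  refine DifferentiableOn.differentiableAt (s := Metric.ball 0 r) ?_
    (Metric.isOpen_ball.mem_nhds (mem_ball_zero_iff.mpr hzr))
  refine Complex.differentiableOn_tsum_of_summable_norm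
    (F := fun n z ↦ ((weight k n : ℂ) * z ^ n) • b n)
    ((summable_weight_mul_pow k ((norm_nonneg z).trans hzr.le) hr).mul_right C)
    (fun n ↦ by fun_prop) Metric.isOpen_ball fun n w hw ↦ (norm_opSeries_term_le hb n w).trans ?_
  have := (mem_ball_zero_iff.mp hw).le
  have := weight_nonneg k n
  have := (norm_nonneg _).trans (hb 0)
  gcongr

lemma hasSum_opSeries [CompleteSpace F] (hb : ∀ n, ‖b n‖ ≤ C) (z : 𝔻) :
    HasSum (fun n ↦ ((weight k n : ℂ) * (z : ℂ) ^ n) • b n) (opSeries k b z) :=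
  (Summable.of_norm_bounded
    ((summable_weight_mul_pow k (norm_nonneg (z : ℂ)) z.norm_lt_one).mul_right C)
    fun n ↦ norm_opSeries_term_le hb n z).hasSum

end OpSeries

/-- The coefficient sequence `n ↦ weight k n • w̄ⁿ v` of the kernel function `K_w v`. -/
noncomputable def kernelCoeff (F : Type*) [NormedAddCommGroup F] [InnerProductSpace ℂ F]
    (k : ℕ) (w : 𝔻) : F →ₗ[ℂ] lp (fun _ : ℕ ↦ F) 2 where
  toFun v := ⟨fun n ↦ ((weight k n : ℂ) * conj (w : ℂ) ^ n) • v, memℓp_gen <| by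
    have hw : ‖(‖(w : ℂ)‖ ^ 2 : ℝ)‖ < 1 := by
      rw [norm_pow, norm_norm]
      exact pow_lt_one₀ (norm_nonneg _) w.norm_lt_one two_ne_zero
    refine ((hasSum_choose_mul_geometric_of_norm_lt_one k hw).summable.mul_right
      (‖v‖ ^ 2)).congr fun n ↦ ?_
    rw [norm_smul, norm_mul, norm_pow, RCLike.norm_conj, Complex.norm_real,
      Real.norm_of_nonneg (weight_nonneg k n), ENNReal.toReal_ofNat, Real.rpow_ofNat, mul_pow,
      mul_pow, weight_sq, ← pow_mul, ← pow_mul, mul_comm n 2]⟩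
  map_add' v v' := by
    ext n
    exact smul_add _ _ _
  map_smul' c v := by
    ext n
    exact smul_comm _ _ _

lemma kernelCoeff_apply (k : ℕ) (w : 𝔻) (v : F) (n : ℕ) :
    kernelCoeff F k w v n = ((weight k n : ℂ) * conj (w : ℂ) ^ n) • v := rfl

lemma inner_kernelCoeff (k : ℕ) (w w' : 𝔻) (v v' : F) :
    ⟪kernelCoeff F k w v, kernelCoeff F k w' v'⟫_ℂ =
      ((1 - (w : ℂ) * conj (w' : ℂ)) ^ (k + 1))⁻¹ * ⟪v, v'⟫_ℂ := by
  refine (lp.hasSum_inner _ _).unique ?_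
  have := (hasSum_choose_mul_geometric_of_norm_lt_one k (norm_mul_conj_lt_one w w')).mul_right
    ⟪v, v'⟫_ℂ
  rw [one_div] at this
  refine this.congr_fun fun n ↦ ?_
  have hw : ((n + k).choose k : ℂ) = (weight k n : ℂ) ^ 2 := by
    rw [← Complex.ofReal_pow, weight_sq, Complex.ofReal_natCast]
  simp only [kernelCoeff_apply, inner_smul_left, inner_smul_right, hw, map_mul, map_pow,
    Complex.conj_conj, Complex.conj_ofReal]
  ring

/-- A square summable sequence orthogonal to the coefficients of all kernel functions vanishes, by
uniqueness of power series. -/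
lemma eq_zero_of_inner_kernelCoeff (k : ℕ) (c : lp (fun _ : ℕ ↦ F) 2)
    (h : ∀ w v, ⟪kernelCoeff F k w v, c⟫_ℂ = 0) : c = 0 := by
  ext n
  refine ext_inner_left ℂ fun v ↦ ?_
  let p : FormalMultilinearSeries ℂ ℂ ℂ :=
    FormalMultilinearSeries.ofScalars ℂ fun n ↦ (weight k n : ℂ) * ⟪v, c n⟫_ℂ
  have hp : HasFPowerSeriesAt (fun _ ↦ (0 : ℂ)) p 0 := by
    rw [hasFPowerSeriesAt_iff]
    filter_upwards [Metric.ball_mem_nhds (0 : ℂ) one_pos] with z hz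
    let w : 𝔻 := ⟨z, by simpa using hz⟩
    have hw : (w : ℂ) = z := rfl
    have := lp.hasSum_inner (𝕜 := ℂ) (kernelCoeff F k w v) c
    rw [h] at this
    refine this.congr_fun fun n ↦ ?_
    simp only [p, FormalMultilinearSeries.coeff_ofScalars, kernelCoeff_apply, inner_smul_left,
      map_mul, map_pow, Complex.conj_conj, Complex.conj_ofReal, hw, smul_eq_mul]
    ring
  have h0 : p.coeff n = 0 := by rw [hp.eq_zero]; rfl
  have hne : (weight k n : ℂ) ≠ 0 := by exact_mod_cast (weight_pos k n).ne'
  simpa [p, FormalMultilinearSeries.coeff_ofScalars, hne] using h0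

variable [CompleteSpace F]

lemma inner_kerFun_kerFun (m : ℕ) (w w' : 𝔻) (v v' : F) :
    ⟪RKHS.kerFun (A2 m F) w v, RKHS.kerFun (A2 m F) w' v'⟫_ℂ =
      ((1 - (w : ℂ) * conj (w' : ℂ)) ^ m)⁻¹ * ⟪v, v'⟫_ℂ := by
  rw [← RKHS.kernel_inner, RKHS.OfKernel.kernel_ofKernel]
  simp [bergmanKernel, inner_smul_left, mul_comm]

/-- The weighted Bergman space is unitarily equivalent to `ℓ²`, through the Taylor coefficients
divided by the weights. -/
lemma exists_coeffEquiv (F : Type*) [NormedAddCommGroup F] [InnerProductSpace ℂ F]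
    [CompleteSpace F] (k : ℕ) : ∃ J : A2 (k + 1) F ≃ₗᵢ[ℂ] lp (fun _ : ℕ ↦ F) 2,
      ∀ w v, J (RKHS.kerFun (A2 (k + 1) F) w v) = kernelCoeff F k w v := by
  obtain ⟨R, hR, hRR⟩ := exists_clm_kerFun (A := A2 (k + 1) F)
    (ContinuousLinearMap.id ℂ (A2 (k + 1) F)) (kernelCoeff F k) fun w w' v v' ↦ by
      rw [inner_kernelCoeff, ContinuousLinearMap.id_apply, ContinuousLinearMap.id_apply,
        inner_kerFun_kerFun]
  have hinner (f g : A2 (k + 1) F) : ⟪R f, R g⟫_ℂ = ⟪f, g⟫_ℂ := by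
    rw [← ContinuousLinearMap.adjoint_inner_right, ← ContinuousLinearMap.comp_apply, hRR]
    simp [ContinuousLinearMap.adjoint_inner_right]
  let J : A2 (k + 1) F →ₗᵢ[ℂ] lp (fun _ : ℕ ↦ F) 2 := (R : _ →ₗ[ℂ] _).isometryOfInner hinner
  have hsurj : Function.Surjective J := by
    have hc : IsClosed (LinearMap.range J.toLinearMap : Set (lp (fun _ : ℕ ↦ F) 2)) :=
      J.isometry.isClosedEmbedding.isClosed_range
    have : CompleteSpace (LinearMap.range J.toLinearMap) := hc.completeSpace_coe
    refine LinearMap.range_eq_top.mp (?_ : LinearMap.range J.toLinearMap = ⊤)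
    rw [← Submodule.orthogonal_eq_bot_iff, Submodule.eq_bot_iff]
    refine fun c hc ↦ eq_zero_of_inner_kernelCoeff k c fun w v ↦
      hc _ ⟨RKHS.kerFun (A2 (k + 1) F) w v, hR w v⟩
  exact ⟨LinearIsometryEquiv.ofSurjective J hsurj, fun w v ↦ hR w v⟩

/-- A choice of the unitary onto `ℓ²` of `exists_coeffEquiv`. -/
noncomputable def coeffEquiv (F : Type*) [NormedAddCommGroup F] [InnerProductSpace ℂ F]
    [CompleteSpace F] (k : ℕ) : A2 (k + 1) F ≃ₗᵢ[ℂ] lp (fun _ : ℕ ↦ F) 2 :=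
  (exists_coeffEquiv F k).choose

lemma coeffEquiv_kerFun (k : ℕ) (w : 𝔻) (v : F) :
    coeffEquiv F k (RKHS.kerFun (A2 (k + 1) F) w v) = kernelCoeff F k w v :=
  (exists_coeffEquiv F k).choose_spec w v

/-- The `n`-th coordinate of `coeffEquiv`: the `n`-th Taylor coefficient divided by the weight. -/
noncomputable def coeffCLM (F : Type*) [NormedAddCommGroup F] [InnerProductSpace ℂ F]
    [CompleteSpace F] (k n : ℕ) : A2 (k + 1) F →L[ℂ] F :=
  lp.evalCLM ℂ (fun _ : ℕ ↦ F) 2 n ∘L (coeffEquiv F k).toContinuousLinearEquiv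

lemma coeffCLM_apply (k n : ℕ) (f : A2 (k + 1) F) : coeffCLM F k n f = coeffEquiv F k f n := rfl

lemma coeffCLM_kerFun (k n : ℕ) (w : 𝔻) (v : F) :
    coeffCLM F k n (RKHS.kerFun (A2 (k + 1) F) w v) =
      ((weight k n : ℂ) * conj (w : ℂ) ^ n) • v := by
  rw [coeffCLM_apply, coeffEquiv_kerFun, kernelCoeff_apply]

lemma norm_coeffCLM_le (k n : ℕ) : ‖coeffCLM F k n‖ ≤ 1 :=
  ContinuousLinearMap.opNorm_le_bound _ zero_le_one fun f ↦ by
    rw [coeffCLM_apply, one_mul]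
    exact (lp.norm_apply_le_norm two_ne_zero _ n).trans_eq ((coeffEquiv F k).norm_map f)

lemma hasSum_weight_smul_coeffCLM (k : ℕ) (z : 𝔻) (f : A2 (k + 1) F) (v : F) :
    HasSum (fun n ↦ ⟪v, ((weight k n : ℂ) * (z : ℂ) ^ n) • coeffCLM F k n f⟫_ℂ) ⟪v, f z⟫_ℂ := by
  rw [← RKHS.kerFun_inner, ← (coeffEquiv F k).inner_map_map, coeffEquiv_kerFun]
  refine (lp.hasSum_inner (𝕜 := ℂ) _ _).congr_fun fun n ↦ ?_
  simp [kernelCoeff_apply, coeffCLM_apply, inner_smul_left]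

end PowerSeries

/-! ### The adjoint of the shift -/

section Shift

variable {F : Type*} [NormedAddCommGroup F] [InnerProductSpace ℂ F] [CompleteSpace F]

lemma adjoint_shift_kerFun {m : ℕ} (hm : 1 ≤ m) (w : 𝔻) (v : F) :
    (shift F hm).adjoint (RKHS.kerFun (A2 m F) w v) =
      conj (w : ℂ) • RKHS.kerFun (A2 m F) w v := by
  refine ext_inner_right ℂ fun f ↦ ?_
  rw [ContinuousLinearMap.adjoint_inner_left, RKHS.kerFun_inner, shift_apply, inner_smul_left,
    RKHS.kerFun_inner, inner_smul_right, Complex.conj_conj]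

/-- On coefficients the adjoint of the shift is a weighted backward shift. -/
lemma weight_smul_coeffCLM_adjoint_shift {k : ℕ} (hm : 1 ≤ k + 1) (f : A2 (k + 1) F) (n : ℕ) :
    (weight k (n + 1) : ℂ) • coeffCLM F k n ((shift F hm).adjoint f) =
      (weight k n : ℂ) • coeffCLM F k (n + 1) f := by
  have : (weight k (n + 1) : ℂ) • coeffCLM F k n ∘L (shift F hm).adjoint =
      (weight k n : ℂ) • coeffCLM F k (n + 1) := by
    refine clm_ext_kerFun fun w v ↦ ?_
    simp only [FunLike.coe_smul, Pi.smul_apply, ContinuousLinearMap.comp_apply,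
      adjoint_shift_kerFun, map_smul, coeffCLM_kerFun, smul_smul]
    ring_nf
  exact DFunLike.congr_fun this f

lemma norm_adjoint_shift_le {m : ℕ} (hm : 1 ≤ m) (f : A2 m F) :
    ‖(shift F hm).adjoint f‖ ≤ ‖f‖ := by
  have hd : DenseRange (kerSum m (fun _ ↦ 1) : (𝔻 →₀ F) →ₗ[ℂ] A2 m F) := by
    simpa only [kerSum, one_smul] using denseRange_lsum_kerFun (A2 m F)
  refine hd.induction_on (p := fun f ↦ ‖(shift F hm).adjoint f‖ ≤ ‖f‖) f
    (isClosed_le (by fun_prop) (by fun_prop)) fun v ↦ ?_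
  have : (shift F hm).adjoint (kerSum m (fun _ ↦ 1) v) = kerSum m (fun x ↦ conj (x : ℂ)) v := by
    simp [kerSum, Finsupp.sum, adjoint_shift_kerFun]
  rw [this]
  simpa using norm_kerSum_conj_le hm v

end Shift

/-! ### Shift-invariant subspaces of the weighted Bergman space -/

section Beurling

variable {E F G : Type*} [NormedAddCommGroup E] [InnerProductSpace ℂ E] [CompleteSpace E]
  [NormedAddCommGroup F] [InnerProductSpace ℂ F] [CompleteSpace F]
  [NormedAddCommGroup G] [InnerProductSpace ℂ G] [CompleteSpace G]

/-- A factorization `⟪B K_w v, B K_w' v'⟫ = (1 - w w̄')⁻¹ ⟪C* K_w v, C* K_w' v'⟫` yields a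
multiplier `θ(z) = ev_z ∘ C` from the Hardy space with `M_θ M_θ* = B* B`. -/
lemma exists_isMultiplier {k : ℕ} (C : E →L[ℂ] A2 (k + 1) F) (B : A2 (k + 1) F →L[ℂ] G)
    (h : ∀ (w w' : 𝔻) (v v' : F), ((1 - (w : ℂ) * conj (w' : ℂ)) ^ 1)⁻¹ *
      ⟪C.adjoint (RKHS.kerFun (A2 (k + 1) F) w v),
        C.adjoint (RKHS.kerFun (A2 (k + 1) F) w' v')⟫_ℂ =
      ⟪B (RKHS.kerFun (A2 (k + 1) F) w v), B (RKHS.kerFun (A2 (k + 1) F) w' v')⟫_ℂ) :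
    ∃ (θ : ℂ → E →L[ℂ] F) (hθ : IsMultiplier 1 (k + 1) θ),
      hθ.mulOp ∘L hθ.mulOp.adjoint = B.adjoint ∘L B := by
  obtain ⟨R, hR, hRR⟩ := exists_clm_kerFun B
    (fun w ↦ (RKHS.kerFun (A2 1 E) w ∘L C.adjoint ∘L RKHS.kerFun (A2 (k + 1) F) w :
      F →L[ℂ] A2 1 E).toLinearMap)
    fun w w' v v' ↦ by
      simp only [ContinuousLinearMap.coe_coe, ContinuousLinearMap.comp_apply,
        inner_kerFun_kerFun]
      exact h w w' v v'
  let b (n : ℕ) : E →L[ℂ] F := coeffCLM F k n ∘L C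
  have hb (n : ℕ) : ‖b n‖ ≤ ‖C‖ := by
    refine (ContinuousLinearMap.opNorm_comp_le _ _).trans ?_
    exact mul_le_of_le_one_left (norm_nonneg _) (norm_coeffCLM_le k n)
  have hev (z : 𝔻) (x : E) : opSeries k b z x = C x z := by
    refine ext_inner_left ℂ fun v ↦ ?_
    have h1 := (innerSL ℂ v ∘L ContinuousLinearMap.apply ℂ F x).hasSum
      (hasSum_opSeries (k := k) hb z)
    exact h1.unique (hasSum_weight_smul_coeffCLM k z (C x) v)
  have hadj (f : A2 1 E) (z : 𝔻) : R.adjoint f z = opSeries k b z (f z) := by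
    refine ext_inner_left ℂ fun v ↦ ?_
    rw [hev, ← RKHS.kerFun_inner, ContinuousLinearMap.adjoint_inner_right, hR,
      ← RKHS.kerFun_inner, ← ContinuousLinearMap.adjoint_inner_left, ← RKHS.kerFun_inner]
    rfl
  have hθ : IsMultiplier 1 (k + 1) (opSeries k b) :=
    ⟨differentiableOn_opSeries hb, fun f ↦ ⟨R.adjoint f, hadj f⟩⟩
  refine ⟨_, hθ, ?_⟩
  have : hθ.mulOp = R.adjoint := by
    ext f : 1
    exact RKHS.ext fun z ↦ by rw [hθ.mulOp_apply, hadj]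
  rw [this, ContinuousLinearMap.adjoint_adjoint, hRR]

/-- An operator `M` for which `M M*` is an orthogonal projection is a partial isometry. -/
lemma isPartialIsometry_of_comp_adjoint {M : E →L[ℂ] F} {S : Submodule ℂ F}
    [S.HasOrthogonalProjection] (h : M ∘L M.adjoint = S.starProjection) :
    IsPartialIsometry M ∧ LinearMap.range (M : E →ₗ[ℂ] F) = S := by
  have hM (y : F) : M (M.adjoint y) = S.starProjection y := DFunLike.congr_fun h y
  have hn (y : F) : ‖M (M.adjoint y)‖ = ‖M.adjoint y‖ := by
    refine (pow_left_inj₀ (norm_nonneg _) (norm_nonneg _) two_ne_zero).mp ?_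
    rw [← inner_self_eq_norm_sq (𝕜 := ℂ), ← inner_self_eq_norm_sq (𝕜 := ℂ),
      ContinuousLinearMap.adjoint_inner_left, hM, Submodule.inner_starProjection_left_eq_right,
      S.starProjection_eq_self_iff.mpr (S.starProjection_apply_mem y)]
  constructor
  · -- `(ker M)ᗮ` is the closure of the range of `M*`, on which `M` is isometric
    intro x hx
    rw [ContinuousLinearMap.orthogonal_ker] at hx
    refine closure_minimal (s := (LinearMap.range (M.adjoint : F →ₗ[ℂ] E) : Set E))
      (t := {x | ‖M x‖ = ‖x‖}) ?_ (isClosed_eq (by fun_prop) (by fun_prop)) hx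
    rintro _ ⟨y, rfl⟩
    exact hn y
  · apply le_antisymm
    · rintro _ ⟨x, rfl⟩
      -- the range of `M` is orthogonal to `ker M* = ker (M M*) = Sᗮ`
      rw [← S.orthogonal_orthogonal]
      intro y hy
      have : M.adjoint y = 0 := by
        rw [← norm_eq_zero, ← hn, hM, (S.starProjection_apply_eq_zero_iff).mpr hy, norm_zero]
      rw [ContinuousLinearMap.coe_coe, ← ContinuousLinearMap.adjoint_inner_left, this,
        inner_zero_left]
    · intro y hy
      exact ⟨M.adjoint y, (hM y).trans (S.starProjection_eq_self_iff.mpr hy)⟩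

/-- For a contraction `M*` and a closed `M`-invariant subspace `S` with projection `P`, the operator
`P - M P M*` is positive, because `P M* = P M* P` gives `‖P M* x‖ ≤ ‖P x‖`; hence it factors as
`C C*`. -/
lemma exists_sq_eq_sub_conj {A : Type*} [NormedAddCommGroup A] [InnerProductSpace ℂ A]
    [CompleteSpace A] {M : A →L[ℂ] A} (hM : ∀ x, ‖M.adjoint x‖ ≤ ‖x‖) (S : Submodule ℂ A)
    [S.HasOrthogonalProjection] (hS : ∀ x ∈ S, M x ∈ S) :
    ∃ C : A →L[ℂ] A, ∀ x y, ⟪C.adjoint x, C.adjoint y⟫_ℂ =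
      ⟪S.starProjection x, S.starProjection y⟫_ℂ -
        ⟪S.starProjection (M.adjoint x), S.starProjection (M.adjoint y)⟫_ℂ := by
  let P := S.starProjection
  let L : A →L[ℂ] A := P - M ∘L P ∘L M.adjoint
  have hPP (x y : A) : ⟪P x, P y⟫_ℂ = ⟪P x, y⟫_ℂ := by
    rw [← S.inner_starProjection_left_eq_right,
      S.starProjection_eq_self_iff.mpr (S.starProjection_apply_mem x)]
  have hL (x y : A) : ⟪L x, y⟫_ℂ = ⟪P x, P y⟫_ℂ - ⟪P (M.adjoint x), P (M.adjoint y)⟫_ℂ := by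
    simp only [L, hPP, FunLike.coe_sub, Pi.sub_apply, inner_sub_left,
      ContinuousLinearMap.comp_apply, ContinuousLinearMap.adjoint_inner_right]
  have hPM (x : A) : P (M.adjoint x) = P (M.adjoint (P x)) := by
    rw [← sub_eq_zero, ← map_sub, ← map_sub]
    refine (S.starProjection_apply_eq_zero_iff).mpr fun y hy ↦ ?_
    rw [ContinuousLinearMap.adjoint_inner_right]
    exact S.sub_starProjection_mem_orthogonal x _ (hS y hy)
  have hpos : L.IsPositive := by
    rw [ContinuousLinearMap.isPositive_iff_complex]
    intro x
    have h1 : ‖P (M.adjoint x)‖ ≤ ‖P x‖ := by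
      rw [hPM]
      exact (S.norm_starProjection_apply_le _).trans (hM _)
    have h2 : ⟪L x, x⟫_ℂ = ((‖P x‖ ^ 2 - ‖P (M.adjoint x)‖ ^ 2 : ℝ) : ℂ) := by
      rw [hL, inner_self_eq_norm_sq_to_K, inner_self_eq_norm_sq_to_K]
      push_cast
      rfl
    rw [h2]
    rw [RCLike.re_eq_complex_re, Complex.ofReal_re, sub_nonneg]
    refine ⟨rfl, ?_⟩
    gcongr
  have hsq : CFC.sqrt L * CFC.sqrt L = L :=
    CFC.sqrt_mul_sqrt_self L ((ContinuousLinearMap.nonneg_iff_isPositive L).mpr hpos)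
  have hsa : (CFC.sqrt L).adjoint = CFC.sqrt L := (CFC.sqrt_nonneg L).isSelfAdjoint.adjoint_eq
  refine ⟨CFC.sqrt L, fun x y ↦ ?_⟩
  rw [← hL, ContinuousLinearMap.adjoint_inner_right, hsa, ← mul_apply_eq_comp, hsq]

/-- Every closed shift-invariant subspace of a weighted Bergman space is the range of a partially
isometric multiplier from a Hardy space. The coefficient space of the Hardy space is taken to be the
whole Bergman space, which is larger than necessary but of the right universe level. -/
lemma exists_isMultiplier_range_eq {F : Type u} [NormedAddCommGroup F] [InnerProductSpace ℂ F]
    [CompleteSpace F] {m : ℕ} (hm : 1 ≤ m) (S : Submodule ℂ (A2 m F)) [S.HasOrthogonalProjection]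
    (hS : ∀ f ∈ S, shift F hm f ∈ S) :
    ∃ (E : Type u) (_ : NormedAddCommGroup E) (_ : InnerProductSpace ℂ E) (_ : CompleteSpace E)
      (θ : ℂ → E →L[ℂ] F) (hθ : IsMultiplier 1 m θ), IsPartialIsometry hθ.mulOp ∧
        LinearMap.range (hθ.mulOp : A2 1 E →ₗ[ℂ] A2 m F) = S := by
  obtain ⟨C, hC⟩ := exists_sq_eq_sub_conj (norm_adjoint_shift_le hm) S hS
  obtain ⟨k, rfl⟩ : ∃ k, m = k + 1 := ⟨m - 1, by omega⟩
  obtain ⟨θ, hθ, h⟩ := exists_isMultiplier C S.starProjection fun w w' v v' ↦ by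
    have := one_sub_mul_conj_ne_zero w w'
    rw [hC, adjoint_shift_kerFun, adjoint_shift_kerFun, map_smul, map_smul, inner_smul_left,
      inner_smul_right, Complex.conj_conj, pow_one]
    field_simp
  refine ⟨A2 (k + 1) F, inferInstance, inferInstance, inferInstance, θ, hθ,
    isPartialIsometry_of_comp_adjoint (h.trans ?_)⟩
  ext f : 1
  rw [ContinuousLinearMap.comp_apply, (isSelfAdjoint_starProjection S).adjoint_eq]
  exact S.starProjection_eq_self_iff.mpr (S.starProjection_apply_mem f)

end Beurling

/-! ### The model of a `B_m`-contraction -/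

section Model

variable {H K : Type*} [NormedAddCommGroup H] [InnerProductSpace ℂ H] [CompleteSpace H]
  [NormedAddCommGroup K] [InnerProductSpace ℂ K] [CompleteSpace K]

/-- An isometry `V` with `V T* = M* V` identifies `T` with the compression of `M` to the range
of `V`. -/
lemma unitarilyEquivalent_compression {T : H →L[ℂ] H} {M : K →L[ℂ] K} (V : H →ₗᵢ[ℂ] K)
    (hV : ∀ h, V (T.adjoint h) = M.adjoint (V h)) (Q : Submodule ℂ K) [Q.HasOrthogonalProjection]
    (hQ : LinearMap.range V.toLinearMap = Q) :
    UnitarilyEquivalent T (compression M Q) := by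
  subst hQ
  refine ⟨V.equivRange, fun h ↦ ?_⟩
  refine ext_inner_left ℂ fun x ↦ ?_
  obtain ⟨y, rfl⟩ := V.equivRange.surjective x
  rw [V.equivRange.inner_map_map, compression, ContinuousLinearMap.comp_apply,
    Submodule.inner_orthogonalProjectionOnto_eq_of_mem_left,
    ← ContinuousLinearMap.adjoint_inner_left]
  change _ = ⟪V y, M (V h)⟫_ℂ
  rw [← ContinuousLinearMap.adjoint_inner_left, ← hV, V.inner_map_map]

lemma norm_defectOp_sq {m : ℕ} {T : H →L[ℂ] H} (hT : (bergmanInv m T).IsPositive) (h : H) :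
    ‖defectOp m T h‖ ^ 2 = defectForm m T h := by
  have hsa : (defectOp m T).adjoint = defectOp m T :=
    (CFC.sqrt_nonneg (bergmanInv m T)).isSelfAdjoint.adjoint_eq
  have hsq : defectOp m T * defectOp m T = bergmanInv m T :=
    CFC.sqrt_mul_sqrt_self _ ((ContinuousLinearMap.nonneg_iff_isPositive _).mpr hT)
  rw [← inner_self_eq_norm_sq (𝕜 := ℂ), ← ContinuousLinearMap.adjoint_inner_left, hsa,
    ← mul_apply_eq_comp, hsq, defectForm]

/-- The defect operator as an operator into the defect space. -/
noncomputable def defectMap (m : ℕ) (T : H →L[ℂ] H) : H →L[ℂ] defectSpace m T :=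
  (defectOp m T).codRestrict (defectSpace m T) fun h ↦
    Submodule.le_topologicalClosure _ ⟨h, rfl⟩

/-- The coefficient sequence `n ↦ weight k n • D T*ⁿ h` of the function `D (1 - z T*)⁻⁽ᵏ⁺¹⁾ h`
depends isometrically on `h`. -/
lemma exists_modelCoeff {k : ℕ} {T : H →L[ℂ] H} (hT : IsBergmanContraction (k + 1) T) :
    ∃ V : H →ₗᵢ[ℂ] lp (fun _ : ℕ ↦ defectSpace (k + 1) T) 2, ∀ h n,
      V h n = (weight k n : ℂ) • defectMap (k + 1) T ((T.adjoint ^ n) h) := by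
  have hpos (h : H) : 0 ≤ defectForm (k + 1) T h := by
    rw [← norm_defectOp_sq hT.nonneg]
    positivity
  have hterm (h : H) (n : ℕ) :
      ‖(weight k n : ℂ) • defectMap (k + 1) T ((T.adjoint ^ n) h)‖ ^ (2 : ENNReal).toReal =
        ((n + k).choose k : ℝ) * defectForm (k + 1) T ((T.adjoint ^ n) h) := by
    rw [ENNReal.toReal_ofNat, Real.rpow_ofNat, norm_smul, Complex.norm_real, mul_pow,
      Real.norm_of_nonneg (weight_nonneg k n), weight_sq, ← norm_defectOp_sq hT.nonneg]
    rfl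
  have hsum (h : H) : HasSum (fun n ↦ ‖(weight k n : ℂ) •
      defectMap (k + 1) T ((T.adjoint ^ n) h)‖ ^ (2 : ENNReal).toReal) (‖h‖ ^ 2) := by
    simpa only [hterm] using hasSum_choose_mul_defectForm hT.cDotZero k hpos h
  let V : H →ₗ[ℂ] lp (fun _ : ℕ ↦ defectSpace (k + 1) T) 2 :=
    { toFun h := ⟨fun n ↦ (weight k n : ℂ) • defectMap (k + 1) T ((T.adjoint ^ n) h),
        memℓp_gen (hsum h).summable⟩
      map_add' x y := by
        ext1
        funext n
        simp only [map_add, smul_add]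
        rfl
      map_smul' c x := by
        ext1
        funext n
        simp only [map_smul, smul_comm _ c]
        rfl }
  refine ⟨⟨V, fun h ↦ ?_⟩, fun h n ↦ rfl⟩
  refine (pow_left_inj₀ (norm_nonneg _) (norm_nonneg _) two_ne_zero).mp ?_
  have := lp.hasSum_norm (p := 2) (by norm_num) (V h)
  have hh := hsum h
  simp only [ENNReal.toReal_ofNat, Real.rpow_ofNat] at this hh
  exact this.unique hh

/-- The map `h ↦ D (1 - z T*)⁻ᵐ h` embeds `H` isometrically into the weighted Bergman space over
the defect space, and intertwines `T*` with the adjoint of the shift. -/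
lemma exists_modelIsometry {m : ℕ} (hm : 1 ≤ m) {T : H →L[ℂ] H} (hT : IsBergmanContraction m T) :
    ∃ V : H →ₗᵢ[ℂ] A2 m (defectSpace m T),
      ∀ h, V (T.adjoint h) = (shift (defectSpace m T) hm).adjoint (V h) := by
  obtain ⟨k, rfl⟩ : ∃ k, m = k + 1 := ⟨m - 1, by omega⟩
  obtain ⟨V, hV⟩ := exists_modelCoeff hT
  let J := coeffEquiv (defectSpace (k + 1) T) k
  refine ⟨J.symm.toLinearIsometry.comp V, fun h ↦ J.injective ?_⟩
  ext1
  funext n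
  have hJ (h : H) (n : ℕ) : coeffCLM (defectSpace (k + 1) T) k n (J.symm (V h)) =
      (weight k n : ℂ) • defectMap (k + 1) T ((T.adjoint ^ n) h) := by
    rw [coeffCLM_apply, ← hV]
    exact congrArg (fun x : lp (fun _ : ℕ ↦ defectSpace (k + 1) T) 2 ↦ x n)
      (J.apply_symm_apply (V h))
  have hne : (weight k (n + 1) : ℂ) ≠ 0 := by exact_mod_cast (weight_pos k (n + 1)).ne'
  -- both sides have the `n`-th coefficient `weight k n • D T*ⁿ⁺¹ h`, seen after scaling
  refine smul_right_injective _ hne ?_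
  have h1 := weight_smul_coeffCLM_adjoint_shift hm (J.symm (V h)) n
  have h2 := hJ (T.adjoint h) n
  rw [hJ, pow_succ, mul_apply_eq_comp] at h1
  refine (congrArg _ h2).trans (Eq.trans ?_ h1.symm)
  exact smul_comm _ _ _

end Model

end BergmanModel

theorem mainTheorem2 {H : Type u} [NormedAddCommGroup H] [InnerProductSpace ℂ H]
    [CompleteSpace H] (m : ℕ) (hm : 1 ≤ m) (T : H →L[ℂ] H)
    (hT : BergmanModel.IsBergmanContraction m T) :
    ∃ (E : Type u) (_ : NormedAddCommGroup E) (_ : InnerProductSpace ℂ E) (_ : CompleteSpace E)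
      (θ : ℂ → E →L[ℂ] BergmanModel.defectSpace m T)
      (hθ : BergmanModel.IsMultiplier 1 m θ),
      BergmanModel.IsPartialIsometry hθ.mulOp ∧
      BergmanModel.UnitarilyEquivalent T
        (BergmanModel.compression (BergmanModel.shift (BergmanModel.defectSpace m T) hm)
          (LinearMap.range
            (hθ.mulOp : BergmanModel.A2 1 E →ₗ[ℂ]
              BergmanModel.A2 m (BergmanModel.defectSpace m T)))ᗮ) := by
  obtain ⟨V, hV⟩ := BergmanModel.exists_modelIsometry hm hT
  have hclosed : IsClosed (LinearMap.range V.toLinearMap :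
      Set (BergmanModel.A2 m (BergmanModel.defectSpace m T))) :=
    V.isometry.isClosedEmbedding.isClosed_range
  have : CompleteSpace (LinearMap.range V.toLinearMap) := hclosed.completeSpace_coe
  obtain ⟨E, i1, i2, i3, θ, hθ, hiso, hrange⟩ := BergmanModel.exists_isMultiplier_range_eq hm
    (LinearMap.range V.toLinearMap)ᗮ fun f hf ↦ by
      rintro _ ⟨h, rfl⟩
      rw [← ContinuousLinearMap.adjoint_inner_left]
      exact (congrArg (fun x ↦ ⟪x, f⟫_ℂ) (hV h)).symm.trans (hf _ ⟨_, rfl⟩)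
  refine ⟨E, i1, i2, i3, θ, hθ, hiso,
    BergmanModel.unitarilyEquivalent_compression V hV _ ?_⟩
  rw [hrange, Submodule.orthogonal_orthogonal]
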